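/- We work with normal modal multi-conclusion rule systems (over the usual modal language with countably many variables). A rule is a pair $\Gamma/\Delta$ of finite sets of modal formulas; a modal algebra $\mathfrak{B}$ (a Boolean algebra with an operation $\Diamond$ such that $\Diamond 0=0$ and $\Diamond(a\vee b)=\Diamond a\vee\Diamond b$) validates it if every valuation in $\mathfrak B$ sending all formulas of $\Gamma$ to $1$ sends some formula of $\Delta$ to $1$. A rule system is a set of rules that contains all $\varphi/\varphi$; $\varphi,\varphi\to\psi/\psi$; $\varphi/\Box\varphi$; and $/\varphi$ for theorems $\varphi$ of $\mathsf K$, and is closed under weakening, cut and substitution. For a rule system $\mathcal S$, let $\mathcal U(\mathcal S)$ be the class of modal algebras validating all rules of $\mathcal S$ (the $\mathcal S$-algebras), $\mathcal U(\mathcal S)_{\mathrm{fin}}$ the class of its finite members, $\mathrm{NExt}(\mathcal S)$ the lattice of rule systems containing $\mathcal S$ ordered by inclusion, and, for a set $R$ of rules, $\mathcal S+R$ the least rule system containing $\mathcal S\cup R$; one says that $\mathcal S+R$ is axiomatized over $\mathcal S$ by $R$. Let $\mathsf{FH}$ be the class of modal algebras of finite height, i.e. those with $\Box^n 0=1$ for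 some $n\in\omega$. An injective Boolean homomorphism $h:\mathfrak A\to\mathfrak B$ between modal algebras is a stable embedding if $\Diamond h(a)\le h(\Diamond a)$ for all $a$. The rule system $\mathcal S$ is stable if $\mathfrak A\in\mathcal U(\mathcal S)$ whenever there is a stable embedding of the modal algebra $\mathfrak A$ into some $\mathfrak B\in\mathcal U(\mathcal S)$. For a finite modal algebra $\mathfrak A$ and $D\subseteq A$, the stable canonical rule $\rho(\mathfrak A,D)$ is $\Gamma/\Delta$ with $$\Gamma=\{p_{a\vee b}\leftrightarrow p_a\vee p_b : a,b\in A\}\cup\{p_{\neg a}\leftrightarrow\neg p_a : a\in A\}\cup\{\Diamond p_a\to p_{\Diamond a}: a\in A\}\cup\{p_{\Diamond a}\to\Diamond p_a: a\in D\},$$ $\Delta=\{p_a: a\in A,\ a\neq 1\}$, where the $p_a$ are distinct variables; $\rho(\mathfrak A,A)$ is the Jankov rule of $\mathfrak A$. An element $x$ of a complete lattice $X$ is a splitting if there is $y\in X$ with $x\not\le y$ and, for every $z\in X$, $x\le z$ or $z\le y$; a union-splitting is the join of a (possibly empty) set of splittings. **Theorem 4.** Let $\mathcal S$ be a stable rule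 system. For any rule system $\mathcal S'\in\mathrm{NExt}(\mathcal S)$, the following are equivalent: 1. $\mathcal U(\mathcal S)\subseteq\mathcal U(\mathcal S')\cup\mathsf{FH}$; 2. $\mathcal U(\mathcal S)_{\mathrm{fin}}\subseteq\mathcal U(\mathcal S')\cup\mathsf{FH}$; 3. $\mathcal S'$ is axiomatized over $\mathcal S$ by Jankov rules of finite $\mathcal S$-algebras of finite height; 4. $\mathcal S'$ is axiomatized over $\mathcal S$ by stable canonical rules of finite modal algebras of finite height; 5. $\mathcal S'\subseteq\mathcal S+\{\rho(\mathfrak A,A):\mathfrak A\in\mathcal U(\mathcal S)_{\mathrm{fin}}\cap\mathsf{FH}\}$. Moreover, any rule system $\mathcal S'\in\mathrm{NExt}(\mathcal S)$ satisfying one (equivalently all) of these conditions is a union-splitting in $\mathrm{NExt}(\mathcal S)$. -/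

import Mathlib

universe u

namespace ModalRules

/-! Modal formulas, rules and rule systems -/

/-- Modal formulas over countably many propositional variables. -/
inductive Formula : Type
  | var : ℕ → Formula
  | bot : Formula
  | imp : Formula → Formula → Formula
  | box : Formula → Formula
  deriving DecidableEq

namespace Formula

/-- Negation. -/
def neg (φ : Formula) : Formula := imp φ bot

/-- Disjunction. -/
def or (φ ψ : Formula) : Formula := imp (neg φ) ψ

/-- Conjunction. -/
def and (φ ψ : Formula) : Formula := neg (imp φ (neg ψ))

/-- Biconditional. -/
def iff (φ ψ : Formula) : Formula := and (imp φ ψ) (imp ψ φ)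

/-- Possibility, the dual of `box`. -/
def dia (φ : Formula) : Formula := neg (box (neg φ))

/-- Uniform substitution. -/
def subst (s : ℕ → Formula) : Formula → Formula
  | var n => s n
  | bot => bot
  | imp φ ψ => imp (subst s φ) (subst s ψ)
  | box φ => box (subst s φ)

end Formula

/-- Theorems of the least normal modal logic `K` (Hilbert calculus). -/
inductive KTheorem : Formula → Prop
  | ax1 (φ ψ : Formula) : KTheorem (φ.imp (ψ.imp φ))
  | ax2 (φ ψ χ : Formula) :
      KTheorem ((φ.imp (ψ.imp χ)).imp ((φ.imp ψ).imp (φ.imp χ)))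
  | ax3 (φ : Formula) : KTheorem (φ.neg.neg.imp φ)
  | axK (φ ψ : Formula) : KTheorem ((φ.imp ψ).box.imp (φ.box.imp ψ.box))
  | mp {φ ψ : Formula} : KTheorem (φ.imp ψ) → KTheorem φ → KTheorem ψ
  | nec {φ : Formula} : KTheorem φ → KTheorem φ.box

/-- A multi-conclusion rule `Γ / Δ`, with `Γ` and `Δ` finite sets of formulas. -/
@[ext] structure Rule : Type where
  prem : Finset Formula
  concl : Finset Formula

/-- Normal modal multi-conclusion rule systems (consequence relations). -/
@[ext] structure RuleSystem : Type where
  carrier : Set Rule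
  refl_mem : ∀ φ : Formula, ⟨{φ}, {φ}⟩ ∈ carrier
  mp_mem : ∀ φ ψ : Formula, ⟨{φ, φ.imp ψ}, {ψ}⟩ ∈ carrier
  nec_mem : ∀ φ : Formula, ⟨{φ}, {φ.box}⟩ ∈ carrier
  thm_mem : ∀ φ : Formula, KTheorem φ → ⟨∅, {φ}⟩ ∈ carrier
  weakening : ∀ Γ Γ' Δ Δ' : Finset Formula,
    ⟨Γ, Δ⟩ ∈ carrier → ⟨Γ ∪ Γ', Δ ∪ Δ'⟩ ∈ carrier
  cut : ∀ (Γ Δ : Finset Formula) (φ : Formula),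
    ⟨Γ, insert φ Δ⟩ ∈ carrier → ⟨insert φ Γ, Δ⟩ ∈ carrier → ⟨Γ, Δ⟩ ∈ carrier
  subst_mem : ∀ (Γ Δ : Finset Formula) (s : ℕ → Formula),
    ⟨Γ, Δ⟩ ∈ carrier → ⟨Γ.image (Formula.subst s), Δ.image (Formula.subst s)⟩ ∈ carrier

/-- Rule systems are ordered by inclusion. -/
instance : PartialOrder RuleSystem :=
  PartialOrder.lift RuleSystem.carrier (fun _ _ h => RuleSystem.ext h)

/-- `S.add R` is `S + R`, the least rule system containing `S` and the set of rules `R`. -/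
def RuleSystem.add (S : RuleSystem) (R : Set Rule) : RuleSystem where
  carrier := {r | ∀ T : RuleSystem, S ≤ T → R ⊆ T.carrier → r ∈ T.carrier}
  refl_mem φ T _ _ := T.refl_mem φ
  mp_mem φ ψ T _ _ := T.mp_mem φ ψ
  nec_mem φ T _ _ := T.nec_mem φ
  thm_mem φ h T _ _ := T.thm_mem φ h
  weakening Γ Γ' Δ Δ' h T hS hR := T.weakening Γ Γ' Δ Δ' (h T hS hR)
  cut Γ Δ φ h h' T hS hR := T.cut Γ Δ φ (h T hS hR) (h' T hS hR)
  subst_mem Γ Δ s h T hS hR := T.subst_mem Γ Δ s (h T hS hR)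

/-- The rule systems extending `S`; as a subtype it is ordered by inclusion. -/
def NExt (S : RuleSystem) : Set RuleSystem := Set.Ici S

/-! Modal algebras -/

/-- A modal algebra (the one-element algebra is allowed). -/
class ModalAlgebra (A : Type u) extends BooleanAlgebra A where
  dia : A → A
  dia_bot : dia ⊥ = ⊥
  dia_sup : ∀ a b : A, dia (a ⊔ b) = dia a ⊔ dia b

open ModalAlgebra (dia)

/-- The dual operation of `dia`. -/
def mbox {A : Type u} [ModalAlgebra A] (a : A) : A := (dia aᶜ)ᶜ

/-- The value of a formula under a valuation in a modal algebra. -/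
def Formula.eval {A : Type u} [ModalAlgebra A] (v : ℕ → A) : Formula → A
  | .var n => v n
  | .bot => ⊥
  | .imp φ ψ => Formula.eval v φ ⇨ Formula.eval v ψ
  | .box φ => mbox (Formula.eval v φ)

/-- Validity of a rule in a modal algebra. -/
def Rule.ValidIn (r : Rule) (A : Type u) [ModalAlgebra A] : Prop :=
  ∀ v : ℕ → A, (∀ γ ∈ r.prem, γ.eval v = ⊤) → ∃ δ ∈ r.concl, δ.eval v = ⊤

/-- Bundled modal algebras, used to speak about classes of modal algebras. -/
structure ModAlg : Type (u + 1) where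
  carrier : Type u
  [inst : ModalAlgebra carrier]

instance : CoeSort ModAlg.{u} (Type u) := ⟨ModAlg.carrier⟩

instance (A : ModAlg.{u}) : ModalAlgebra A := A.inst

/-- The universal class of a rule system: all modal algebras validating all of its rules. -/
def U (S : RuleSystem) : Set ModAlg.{u} := {A | ∀ r ∈ S.carrier, r.ValidIn A}

/-- The class of finite modal algebras. -/
def FinAlg : Set ModAlg.{u} := {A | Finite A}

/-- The class of modal algebras of finite height. -/
def FH : Set ModAlg.{u} := {A | ∃ n : ℕ, mbox^[n] (⊥ : A) = ⊤}

/-- `StableEmbeds A B D`: there is a stable embedding of `A` into `B` that satisfies the closed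
domain condition for `D`. -/
def StableEmbeds (A B : Type u) [ModalAlgebra A] [ModalAlgebra B] (D : Set A) : Prop :=
  ∃ h : BoundedLatticeHom A B, Function.Injective h ∧
    (∀ a, dia (h a) ≤ h (dia a)) ∧ ∀ a ∈ D, h (dia a) = dia (h a)

/-- A class of modal algebras is stable if it is closed under stable subalgebras. -/
def IsStableClass (C : Set ModAlg.{u}) : Prop :=
  ∀ A B : ModAlg.{u}, B ∈ C → StableEmbeds A B ∅ → A ∈ C

/-- A rule system is stable if its universal class is stable. -/
def RuleSystem.IsStable (S : RuleSystem) : Prop := IsStableClass (U.{u} S)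

/-! Stable canonical rules -/

/-- The variable `p_a` attached to an element `a` of a finite algebra. -/
noncomputable def pvar {A : Type u} [Finite A] (a : A) : Formula :=
  .var (Finite.equivFin A a)

open Classical in
/-- The stable canonical rule `ρ(A, D)` of a finite modal algebra `A` and `D ⊆ A`. -/
noncomputable def stableCanonicalRule (A : Type u) [ModalAlgebra A] [Finite A] (D : Set A) :
    Rule :=
  letI : Fintype A := Fintype.ofFinite A
  { prem :=
      (Finset.univ.image fun x : A × A => (pvar (x.1 ⊔ x.2)).iff ((pvar x.1).or (pvar x.2))) ∪
      (Finset.univ.image fun a : A => (pvar aᶜ).iff (pvar a).neg) ∪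
      (Finset.univ.image fun a : A => (pvar a).dia.imp (pvar (dia a))) ∪
      ((Finset.univ.filter fun a : A => a ∈ D).image fun a : A =>
        (pvar (dia a)).imp (pvar a).dia)
    concl := (Finset.univ.filter fun a : A => a ≠ ⊤).image pvar }

/-- The Jankov rule `ρ(A, A)` of a finite modal algebra `A`. -/
noncomputable def jankovRule (A : Type u) [ModalAlgebra A] [Finite A] : Rule :=
  stableCanonicalRule A Set.univ

/-- The stable canonical rules `ρ(A, D)` with `A` in the class `C` and finite, and `D ⊆ A`. -/
def stableCanonicalRulesOf (C : Set ModAlg.{u}) : Set Rule :=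
  {r | ∃ (A : ModAlg.{u}) (_ : Finite A) (D : Set A), A ∈ C ∧ r = stableCanonicalRule A D}

/-- The Jankov rules `ρ(A, A)` with `A` in the class `C` and finite. -/
def jankovRulesOf (C : Set ModAlg.{u}) : Set Rule :=
  {r | ∃ (A : ModAlg.{u}) (_ : Finite A), A ∈ C ∧ r = jankovRule A}

/-- `S'` is axiomatized over `S` by (some set of) rules taken from `Q`. -/
def AxiomatizedOverBy (S' S : RuleSystem) (Q : Set Rule) : Prop :=
  ∃ R : Set Rule, R ⊆ Q ∧ S' = S.add R

/-! Splittings -/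

/-- `x` is a splitting: the first component of a splitting pair `(x, y)`. -/
def IsSplitting {X : Type*} [PartialOrder X] (x : X) : Prop :=
  ∃ y : X, ¬ x ≤ y ∧ ∀ z : X, x ≤ z ∨ z ≤ y

/-- `z` is a union-splitting: the join of a (possibly empty) set of splittings. -/
def IsUnionSplitting {X : Type*} [PartialOrder X] (z : X) : Prop :=
  ∃ Y : Set X, (∀ y ∈ Y, IsSplitting y) ∧ IsLUB Y z

end ModalRules

open ModalRules

namespace ModalRules

/-! Propositional theories and their Lindenbaum algebras -/

/-! The core is that condition 2 yields an axiomatization by Jankov rules. By algebraic completeness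
(`exists_refuting`), if the Jankov rules in `S'` of finite `S`-algebras of finite height fail to
derive a rule r of `S'`, some `S`-algebra B validates those Jankov rules and refutes r. Filtration
gives a finite stable subalgebra A of B refuting r, and stability of `S` makes A an `S`-algebra.
Since A is not an `S'`-algebra, condition 2 gives it finite height, and a stable embedding carries
finite height up to B. Algebras of finite height are locally finite, so r already fails in a finite
genuine subalgebra C of B. Then C is an `S`-algebra but not an `S'`-algebra; hence it has finite
height and its Jankov rule lies in `S'`. But B refutes that rule, because C embeds in B: a
contradiction.

Conversely, an algebra refuting a stable canonical rule of an algebra of finite height contains that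
algebra stably, so it has finite height itself. Union-splitting holds because the Jankov rule of a
finite `S`-algebra splits the lattice, the other half of the pair being the rule system of that
algebra. -/

/-- A set of formulas containing the classical tautologies and closed under modus ponens. -/
structure IsTheory (L : Set Formula) : Prop where
  ax1 : ∀ φ ψ : Formula, φ.imp (ψ.imp φ) ∈ L
  ax2 : ∀ φ ψ χ : Formula, (φ.imp (ψ.imp χ)).imp ((φ.imp ψ).imp (φ.imp χ)) ∈ L
  ax3 : ∀ φ : Formula, φ.neg.neg.imp φ ∈ L
  mp : ∀ {φ ψ : Formula}, φ.imp ψ ∈ L → φ ∈ L → ψ ∈ L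

namespace IsTheory

variable {L : Set Formula} {φ ψ χ θ : Formula}

theorem weak (hL : IsTheory L) (h : ψ ∈ L) : φ.imp ψ ∈ L := hL.mp (hL.ax1 _ _) h

theorem imp_self (hL : IsTheory L) (φ : Formula) : φ.imp φ ∈ L :=
  hL.mp (hL.mp (hL.ax2 φ (φ.imp φ) φ) (hL.ax1 _ _)) (hL.ax1 _ _)

/-- Axiom `ax2` says precisely that the consequences of φ are closed under modus ponens. Using this
set as the extension `M` below gives the deduction theorem without induction on derivations. -/
theorem adjoin (hL : IsTheory L) (φ : Formula) : IsTheory {ψ | φ.imp ψ ∈ L} where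
  ax1 _ _ := hL.weak (hL.ax1 _ _)
  ax2 _ _ _ := hL.weak (hL.ax2 _ _ _)
  ax3 _ := hL.weak (hL.ax3 _)
  mp h h' := hL.mp (hL.mp (hL.ax2 _ _ _) h) h'

/-- The deduction theorem. -/
theorem intro (hL : IsTheory L)
    (h : ∀ M : Set Formula, IsTheory M → L ⊆ M → φ ∈ M → ψ ∈ M) : φ.imp ψ ∈ L :=
  h {ψ | φ.imp ψ ∈ L} (hL.adjoin φ) (fun _ hψ => hL.weak hψ) (hL.imp_self φ)

/-- Proof by contradiction. -/
theorem by_contra (hL : IsTheory L)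
    (h : ∀ M : Set Formula, IsTheory M → L ⊆ M → φ.neg ∈ M → Formula.bot ∈ M) : φ ∈ L :=
  hL.mp (hL.ax3 φ) (hL.intro h)

theorem exfalso (hL : IsTheory L) (h : Formula.bot ∈ L) : φ ∈ L :=
  hL.mp (hL.ax3 φ) (hL.weak h)

theorem trans (hL : IsTheory L) (h : φ.imp ψ ∈ L) (h' : ψ.imp χ ∈ L) : φ.imp χ ∈ L :=
  hL.intro fun _ hM s a => hM.mp (s h') (hM.mp (s h) a)

theorem or_left (hL : IsTheory L) (φ ψ : Formula) : φ.imp (φ.or ψ) ∈ L :=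
  hL.intro fun _ hM _ a => hM.intro fun _ hN t b => hN.exfalso (hN.mp b (t a))

theorem or_right (hL : IsTheory L) (φ ψ : Formula) : ψ.imp (φ.or ψ) ∈ L := hL.ax1 _ _

theorem or_elim (hL : IsTheory L) (h : φ.imp χ ∈ L) (h' : ψ.imp χ ∈ L) :
    (φ.or ψ).imp χ ∈ L :=
  hL.intro fun _ hM s a => hM.by_contra fun _ hN t c =>
    hN.mp c (hN.mp (t (s h')) (hN.mp (t a) (hN.trans (t (s h)) c)))

theorem and_left (hL : IsTheory L) (φ ψ : Formula) : (φ.and ψ).imp φ ∈ L :=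
  hL.intro fun _ hM _ a => hM.by_contra fun _ hN t c =>
    hN.mp (t a) (hN.intro fun _ hO u b => hO.exfalso (hO.mp (u c) b))

theorem and_right (hL : IsTheory L) (φ ψ : Formula) : (φ.and ψ).imp ψ ∈ L :=
  hL.intro fun _ hM _ a => hM.by_contra fun _ hN t c => hN.mp (t a) (hN.weak c)

theorem and_intro (hL : IsTheory L) (h : φ ∈ L) (h' : ψ ∈ L) : φ.and ψ ∈ L :=
  hL.intro fun _ hM s a => hM.mp (hM.mp a (s h)) (s h')

theorem le_and (hL : IsTheory L) (h : χ.imp φ ∈ L) (h' : χ.imp ψ ∈ L) :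
    χ.imp (φ.and ψ) ∈ L :=
  hL.intro fun _ hM s a => hM.and_intro (hM.mp (s h) a) (hM.mp (s h') a)

theorem contrapose (hL : IsTheory L) (h : φ.imp ψ ∈ L) : ψ.neg.imp φ.neg ∈ L :=
  hL.intro fun _ hM s a => hM.trans (s h) a

theorem not_not_intro (hL : IsTheory L) (φ : Formula) : φ.imp φ.neg.neg ∈ L :=
  hL.intro fun _ hM _ a => hM.intro fun _ hN t b => hN.mp b (t a)

theorem or_and_le (hL : IsTheory L) (φ ψ χ : Formula) :
    ((φ.or ψ).and (φ.or χ)).imp (φ.or (ψ.and χ)) ∈ L :=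
  hL.intro fun _ hM _ a => hM.intro fun _ hN t b =>
    hN.and_intro (hN.mp (hN.mp (hN.and_left _ _) (t a)) b)
      (hN.mp (hN.mp (hN.and_right _ _) (t a)) b)

end IsTheory

/-- A theory closed under necessitation and containing the axiom `K`. -/
structure IsModalTheory (L : Set Formula) : Prop extends IsTheory L where
  axK : ∀ φ ψ : Formula, (φ.imp ψ).box.imp (φ.box.imp ψ.box) ∈ L
  nec : ∀ {φ : Formula}, φ ∈ L → φ.box ∈ L

namespace IsModalTheory

variable {L : Set Formula} {φ ψ : Formula}

theorem box_mono (hL : IsModalTheory L) (h : φ.imp ψ ∈ L) : φ.box.imp ψ.box ∈ L :=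
  hL.mp (hL.axK _ _) (hL.nec h)

theorem dia_mono (hL : IsModalTheory L) (h : φ.imp ψ ∈ L) : φ.dia.imp ψ.dia ∈ L :=
  hL.contrapose (hL.box_mono (hL.contrapose h))

theorem dia_or_le (hL : IsModalTheory L) (φ ψ : Formula) :
    (φ.or ψ).dia.imp (φ.dia.or ψ.dia) ∈ L := by
  have h : φ.neg.imp (ψ.neg.imp (φ.or ψ).neg) ∈ L :=
    hL.intro fun _ hM _ a => hM.intro fun _ hN t b => hN.or_elim (t a) b
  have h' : φ.neg.box.imp (ψ.neg.box.imp (φ.or ψ).neg.box) ∈ L :=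
    hL.trans (hL.box_mono h) (hL.axK _ _)
  exact hL.intro fun _ hM s a => hM.intro fun _ hN t b => hN.intro fun _ hO w c =>
    hO.mp (w (t a)) (hO.mp (hO.mp (w (t (s h'))) (hO.mp (hO.ax3 _) (w b))) c)

end IsModalTheory

/-- Provable equivalence over a theory. -/
def lindSetoid {L : Set Formula} (hL : IsModalTheory L) : Setoid (ULift.{u} Formula) where
  r φ ψ := φ.down.imp ψ.down ∈ L ∧ ψ.down.imp φ.down ∈ L
  iseqv := ⟨fun _ => ⟨hL.imp_self _, hL.imp_self _⟩, fun h => ⟨h.2, h.1⟩,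
    fun h h' => ⟨hL.trans h.1 h'.1, hL.trans h'.2 h.2⟩⟩

/-- The Lindenbaum algebra of a modal theory. -/
def Lind {L : Set Formula} (hL : IsModalTheory L) : Type u := Quotient (lindSetoid.{u} hL)

namespace Lind

variable {L : Set Formula} {hL : IsModalTheory L}

/-- The class of a formula. -/
def mk (hL : IsModalTheory L) (φ : Formula) : Lind.{u} hL := Quotient.mk (lindSetoid hL) ⟨φ⟩

theorem exists_rep (a : Lind.{u} hL) : ∃ φ, mk hL φ = a :=
  Quotient.inductionOn a fun φ => ⟨φ.down, rfl⟩

theorem ind {p : Lind.{u} hL → Prop} (h : ∀ φ, p (mk hL φ)) (a : Lind.{u} hL) : p a := by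
  obtain ⟨φ, rfl⟩ := exists_rep a
  exact h φ

theorem sound {φ ψ : Formula} (h : φ.imp ψ ∈ L) (h' : ψ.imp φ ∈ L) :
    mk.{u} hL φ = mk hL ψ := Quotient.sound ⟨h, h'⟩

/-- Lift of a monotone or antitone unary connective. -/
def map (f : Formula → Formula)
    (hf : ∀ φ ψ, φ.imp ψ ∈ L → ψ.imp φ ∈ L → (f φ).imp (f ψ) ∈ L) :
    Lind.{u} hL → Lind.{u} hL :=
  Quotient.lift (fun φ => mk hL (f φ.down))
    fun _ _ h => sound (hf _ _ h.1 h.2) (hf _ _ h.2 h.1)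

/-- Lift of a binary connective. -/
def map₂ (f : Formula → Formula → Formula)
    (hf : ∀ φ ψ φ' ψ', φ.imp φ' ∈ L → ψ.imp ψ' ∈ L → (f φ ψ).imp (f φ' ψ') ∈ L) :
    Lind.{u} hL → Lind.{u} hL → Lind.{u} hL :=
  Quotient.lift₂ (fun φ ψ => mk hL (f φ.down ψ.down))
    fun _ _ _ _ h h' => sound (hf _ _ _ _ h.1 h'.1) (hf _ _ _ _ h.2 h'.2)

instance : LE (Lind.{u} hL) where
  le := Quotient.lift₂ (fun φ ψ => φ.down.imp ψ.down ∈ L) fun _ _ _ _ h h' =>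
    propext ⟨fun k => hL.trans h.2 (hL.trans k h'.1), fun k => hL.trans h.1 (hL.trans k h'.2)⟩

instance : BooleanAlgebra (Lind.{u} hL) where
  le := (· ≤ ·)
  le_refl := ind fun _ => hL.imp_self _
  le_trans := ind fun _ => ind fun _ => ind fun _ h h' => hL.trans h h'
  le_antisymm := ind fun _ => ind fun _ h h' => sound h h'
  sup := map₂ Formula.or fun _ _ _ _ h h' =>
    hL.or_elim (hL.trans h (hL.or_left _ _)) (hL.trans h' (hL.or_right _ _))
  inf := map₂ Formula.and fun _ _ _ _ h h' =>
    hL.le_and (hL.trans (hL.and_left _ _) h) (hL.trans (hL.and_right _ _) h')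
  compl := map Formula.neg fun _ _ _ h => hL.contrapose h
  top := mk hL (Formula.bot.imp Formula.bot)
  bot := mk hL Formula.bot
  le_sup_left := ind fun _ => ind fun _ => hL.or_left _ _
  le_sup_right := ind fun _ => ind fun _ => hL.or_right _ _
  sup_le := ind fun _ => ind fun _ => ind fun _ h h' => hL.or_elim h h'
  inf_le_left := ind fun _ => ind fun _ => hL.and_left _ _
  inf_le_right := ind fun _ => ind fun _ => hL.and_right _ _
  le_inf := ind fun _ => ind fun _ => ind fun _ h h' => hL.le_and h h'
  le_sup_inf := ind fun _ => ind fun _ => ind fun _ => hL.or_and_le _ _ _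
  inf_compl_le_bot := ind fun _ => hL.intro fun _ hM _ a =>
    hM.mp (hM.mp (hM.and_right _ _) a) (hM.mp (hM.and_left _ _) a)
  top_le_sup_compl := ind fun _ => hL.weak (hL.imp_self _)
  le_top := ind fun _ => hL.weak (hL.imp_self _)
  bot_le := ind fun _ => hL.intro fun _ hM _ a => hM.exfalso a

instance : ModalAlgebra (Lind.{u} hL) where
  dia := map Formula.dia fun _ _ h _ => hL.dia_mono h
  dia_bot := sound
    (hL.intro fun _ hM s a => hM.mp a (s (hL.nec (hL.imp_self _))))
    (hL.intro fun _ hM _ a => hM.exfalso a)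
  dia_sup := ind fun _ => ind fun _ => sound (hL.dia_or_le _ _)
    (hL.or_elim (hL.dia_mono (hL.or_left _ _)) (hL.dia_mono (hL.or_right _ _)))

theorem mk_eq_top {φ : Formula} : mk.{u} hL φ = ⊤ ↔ φ ∈ L := by
  rw [eq_top_iff]
  exact ⟨fun h => hL.mp h (hL.imp_self _), fun h => hL.weak h⟩

theorem mk_himp (φ ψ : Formula) : mk.{u} hL φ ⇨ mk hL ψ = mk hL (φ.imp ψ) := by
  rw [himp_eq, sup_comm]
  refine sound (φ := φ.neg.or ψ) ?_ ?_
  · exact hL.intro fun _ hM _ a => hM.intro fun _ hN t b =>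
      hN.mp (t a) (hN.mp (hN.not_not_intro _) b)
  · exact hL.intro fun _ hM _ a => hM.intro fun _ hN t b =>
      hN.mp (t a) (hN.mp (hN.ax3 _) b)

theorem mbox_mk (φ : Formula) : mbox (mk.{u} hL φ) = mk hL φ.box := by
  refine sound (φ := φ.neg.neg.box.neg.neg) ?_ ?_
  · exact hL.trans (hL.ax3 _) (hL.box_mono (hL.ax3 _))
  · exact hL.trans (hL.box_mono (hL.not_not_intro _)) (hL.not_not_intro _)

theorem eval_mk (s : ℕ → Formula) (φ : Formula) :
    φ.eval (fun n => mk.{u} hL (s n)) = mk hL (φ.subst s) := by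
  induction φ with
  | var n => rfl
  | bot => rfl
  | imp φ ψ h h' => simp only [Formula.eval, Formula.subst, h, h', mk_himp]
  | box φ h => simp only [Formula.eval, Formula.subst, h, mbox_mk]

end Lind

/-! Completeness -/

namespace RuleSystem

theorem mem_mono (T : RuleSystem) {Γ Γ' Δ Δ' : Finset Formula} (h : ⟨Γ, Δ⟩ ∈ T.carrier)
    (hΓ : Γ ⊆ Γ') (hΔ : Δ ⊆ Δ') : ⟨Γ', Δ'⟩ ∈ T.carrier := by
  have := T.weakening Γ Γ' Δ Δ' h
  rwa [Finset.union_eq_right.2 hΓ, Finset.union_eq_right.2 hΔ] at this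

/-- A rule outside a rule system is separated from it by a set of formulas closed under the
rules of the system. -/
theorem exists_separating (T : RuleSystem) {r : Rule} (hr : r ∉ T.carrier) :
    ∃ L : Set Formula, (∀ γ ∈ r.prem, γ ∈ L) ∧ (∀ δ ∈ r.concl, δ ∉ L) ∧
      ∀ q ∈ T.carrier, (∀ γ ∈ q.prem, γ ∈ L) → ∃ δ ∈ q.concl, δ ∈ L := by
  -- Sets of signed formulas: `inl` asserts, `inr` rejects. Membership in `F` means that no rule of
  -- `T` leads from asserted to rejected formulas. Rules are finite, so `F` has finite character and
  -- Tukey's lemma applies.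
  let F : Set (Set (Formula ⊕ Formula)) := {X | ∀ Γ Δ : Finset Formula,
    (∀ γ ∈ Γ, Sum.inl γ ∈ X) → (∀ δ ∈ Δ, Sum.inr δ ∈ X) → ⟨Γ, Δ⟩ ∉ T.carrier}
  have hF : Order.IsOfFiniteCharacter F := by
    intro X
    refine ⟨fun h Y hY _ Γ Δ h1 h2 => h Γ Δ (fun γ g => hY (h1 γ g)) fun δ g => hY (h2 δ g),
      fun h Γ Δ h1 h2 => ?_⟩
    refine h (Sum.inl '' (Γ : Set Formula) ∪ Sum.inr '' (Δ : Set Formula)) ?_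
      ((Γ.finite_toSet.image _).union (Δ.finite_toSet.image _)) Γ Δ (by simp) (by simp)
    rintro _ (⟨γ, g, rfl⟩ | ⟨δ, g, rfl⟩)
    exacts [h1 γ g, h2 δ g]
  have h0 : Sum.inl '' (r.prem : Set Formula) ∪ Sum.inr '' (r.concl : Set Formula) ∈ F := by
    intro Γ Δ h1 h2 h
    refine hr (T.mem_mono h (fun γ g => ?_) fun δ g => ?_)
    · simpa using h1 γ g
    · simpa using h2 δ g
  obtain ⟨X, hX, hmax⟩ := hF.exists_maximal h0
  have hXF : X ∈ F := hmax.prop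
  -- By maximality, if φ has neither sign then each sign creates a conflict; cut on φ merges the two
  -- conflicts into one inside `X`.
  have hdich : ∀ φ, Sum.inl φ ∈ X ∨ Sum.inr φ ∈ X := by
    intro φ
    by_contra! hφ
    have hl : insert (Sum.inl φ) X ∉ F := fun h =>
      hφ.1 (hmax.le_of_ge h (Set.subset_insert _ _) (Set.mem_insert _ _))
    have hr : insert (Sum.inr φ) X ∉ F := fun h =>
      hφ.2 (hmax.le_of_ge h (Set.subset_insert _ _) (Set.mem_insert _ _))
    simp only [F, Set.mem_ofPred_eq, not_forall, not_not] at hl hr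
    obtain ⟨Γ₁, Δ₁, a₁, b₁, c₁⟩ := hl
    obtain ⟨Γ₂, Δ₂, a₂, b₂, c₂⟩ := hr
    refine hXF (Γ₁.erase φ ∪ Γ₂) (Δ₁ ∪ Δ₂.erase φ) ?_ ?_ (T.cut _ _ φ ?_ ?_)
    · intro γ g
      rcases Finset.mem_union.1 g with g | g
      · simpa [Finset.ne_of_mem_erase g] using a₁ γ (Finset.mem_of_mem_erase g)
      · simpa using a₂ γ g
    · intro δ g
      rcases Finset.mem_union.1 g with g | g
      · simpa using b₁ δ g
      · simpa [Finset.ne_of_mem_erase g] using b₂ δ (Finset.mem_of_mem_erase g)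
    · refine T.mem_mono c₂ Finset.subset_union_right fun δ g => ?_
      by_cases h : δ = φ <;> simp [h, g]
    · refine T.mem_mono c₁ (fun γ g => ?_) Finset.subset_union_left
      by_cases h : γ = φ <;> simp [h, g]
  refine ⟨{φ | Sum.inl φ ∈ X}, fun γ g => hX (Or.inl ⟨γ, g, rfl⟩), fun δ g h => ?_,
    fun q hq h => ?_⟩
  · exact hXF {δ} {δ} (by simpa using h)
      (by simpa using hX (Or.inr ⟨δ, g, rfl⟩)) (T.refl_mem δ)
  · by_contra! hc
    exact hXF q.prem q.concl h (fun δ g => (hdich δ).resolve_left (hc δ g)) hq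

/-- Algebraic completeness of rule systems. -/
theorem exists_refuting (T : RuleSystem) {r : Rule} (hr : r ∉ T.carrier) :
    ∃ A : ModAlg.{u}, A ∈ U T ∧ ¬ r.ValidIn A := by
  obtain ⟨L, h1, h2, h3⟩ := T.exists_separating hr
  have thm : ∀ φ, KTheorem φ → φ ∈ L := fun φ h => by simpa using h3 _ (T.thm_mem φ h)
  have hL : IsModalTheory L :=
    { ax1 := fun _ _ => thm _ (.ax1 _ _)
      ax2 := fun _ _ _ => thm _ (.ax2 _ _ _)
      ax3 := fun _ => thm _ (.ax3 _)
      axK := fun _ _ => thm _ (.axK _ _)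
      mp := fun {φ ψ} h h' => by simpa [h, h'] using h3 _ (T.mp_mem φ ψ)
      nec := fun {φ} h => by simpa [h] using h3 _ (T.nec_mem φ) }
  refine ⟨⟨Lind.{u} hL⟩, fun q hq v hv => ?_, fun h => ?_⟩
  -- A valuation in the Lindenbaum algebra is a substitution up to provable equivalence, so closure
  -- of `T` under substitution gives validity.
  · choose s hs using fun n => Lind.exists_rep (v n)
    obtain rfl : (fun n => Lind.mk hL (s n)) = v := funext hs
    simp only [Lind.eval_mk, Lind.mk_eq_top] at hv ⊢
    simpa using h3 _ (T.subst_mem _ _ s hq) (by simpa using hv)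
  · have hid : ∀ φ : Formula, φ.subst Formula.var = φ := by
      intro φ
      induction φ <;> simp_all [Formula.subst]
    obtain ⟨δ, hδ, e⟩ := h (fun n => Lind.mk hL (.var n)) fun γ hγ => by
      rw [Lind.eval_mk, Lind.mk_eq_top, hid]
      exact h1 γ hγ
    rw [Lind.eval_mk, Lind.mk_eq_top, hid] at e
    exact h2 δ hδ e

end RuleSystem

open ModalRules.ModalAlgebra (dia)

/-! Modal algebras and evaluation -/

section Algebra

variable {A B : Type u} [ModalAlgebra A] [ModalAlgebra B]

theorem dia_mono {a b : A} (h : a ≤ b) : dia a ≤ dia b := by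
  rw [← sup_eq_right] at h ⊢
  rw [← ModalAlgebra.dia_sup, h]

theorem mbox_inf (a b : A) : mbox (a ⊓ b) = mbox a ⊓ mbox b := by
  simp [mbox, ModalAlgebra.dia_sup]

theorem mbox_top : mbox (⊤ : A) = ⊤ := by
  simp [mbox, ModalAlgebra.dia_bot]

theorem mbox_mono {a b : A} (h : a ≤ b) : mbox a ≤ mbox b :=
  compl_le_compl (dia_mono (compl_le_compl h))

namespace Formula

variable (v : ℕ → A) (φ ψ : Formula)

@[simp] theorem eval_neg : φ.neg.eval v = (φ.eval v)ᶜ := himp_bot _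

@[simp] theorem eval_or : (φ.or ψ).eval v = φ.eval v ⊔ ψ.eval v := by
  change φ.neg.eval v ⇨ ψ.eval v = _
  rw [eval_neg, himp_eq, compl_compl, sup_comm]

@[simp] theorem eval_imp_eq_top : (φ.imp ψ).eval v = ⊤ ↔ φ.eval v ≤ ψ.eval v := himp_eq_top_iff

@[simp] theorem eval_iff_eq_top : (φ.iff ψ).eval v = ⊤ ↔ φ.eval v = ψ.eval v := by
  have : (φ.iff ψ).eval v = (φ.imp ψ).eval v ⊓ (ψ.imp φ).eval v := by
    rw [iff, and, eval_neg]
    change ((φ.imp ψ).eval v ⇨ (ψ.imp φ).neg.eval v)ᶜ = _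
    rw [eval_neg, himp_eq, compl_sup, compl_compl, compl_compl, inf_comm]
  rw [this, inf_eq_top_iff, eval_imp_eq_top, eval_imp_eq_top, le_antisymm_iff]

@[simp] theorem eval_dia : φ.dia.eval v = ModalAlgebra.dia (φ.eval v) := by
  rw [dia, eval_neg]
  change (mbox (φ.neg.eval v))ᶜ = _
  rw [eval_neg, mbox, compl_compl, compl_compl]

theorem eval_subst (s : ℕ → Formula) : (φ.subst s).eval v = φ.eval fun n => (s n).eval v := by
  induction φ <;> simp_all [subst, eval]

theorem _root_.ModalRules.KTheorem.eval_eq_top {φ : Formula} (h : KTheorem φ) :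
    φ.eval v = ⊤ := by
  induction h with
  | ax1 φ ψ => simp [eval]
  | ax2 φ ψ χ =>
    rw [eval_imp_eq_top]
    simp only [eval, le_himp_iff]
    calc _ ≤ (φ.eval v ⇨ ψ.eval v ⇨ χ.eval v) ⊓ φ.eval v ⊓ ((φ.eval v ⇨ ψ.eval v) ⊓ φ.eval v) :=
          le_inf (inf_le_inf_right _ inf_le_left) (inf_le_inf_right _ inf_le_right)
      _ ≤ (ψ.eval v ⇨ χ.eval v) ⊓ ψ.eval v := inf_le_inf himp_inf_le himp_inf_le
      _ ≤ _ := himp_inf_le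
  | ax3 φ => rw [eval_imp_eq_top, eval_neg, eval_neg, compl_compl]
  | axK φ ψ =>
    rw [eval_imp_eq_top]
    simp only [eval, le_himp_iff]
    rw [← mbox_inf]
    exact mbox_mono himp_inf_le
  | mp _ _ h h' => rwa [eval_imp_eq_top, h', top_le_iff] at h
  | nec _ h => rw [eval, h, mbox_top]

/-- The value of a formula depends on finitely many variables. -/
theorem eventually_eval_congr :
    ∀ᶠ N in Filter.atTop, ∀ v w : ℕ → A, (∀ n < N, v n = w n) → φ.eval v = φ.eval w := by
  induction φ with
  | var m =>
    filter_upwards [Filter.eventually_gt_atTop m] with N hN v w h using h m hN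
  | bot => exact .of_forall fun _ _ _ _ => rfl
  | imp φ ψ h h' =>
    filter_upwards [h, h'] with N h h' v w e
    simp only [eval, h v w e, h' v w e]
  | box φ h =>
    filter_upwards [h] with N h v w e
    simp only [eval, h v w e]

/-- The values of the subformulas of a formula, except falsum. -/
def subvalues : Formula → Set A
  | var n => {v n}
  | bot => ∅
  | imp φ ψ => subvalues φ ∪ subvalues ψ
  | box φ => insert (φ.box.eval v) (subvalues φ)

theorem finite_subvalues : (subvalues v φ).Finite := by
  induction φ <;> simp_all [subvalues]

theorem eval_map (h : BoundedLatticeHom A B) (hd : ∀ a, h (ModalAlgebra.dia a) =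
    ModalAlgebra.dia (h a)) :
    φ.eval (fun n => h (v n)) = h (φ.eval v) := by
  induction φ <;> simp_all [eval, mbox, himp_eq]

end Formula

/-! Stable embeddings -/

theorem StableEmbeds.refl (A : Type u) [ModalAlgebra A] (D : Set A) : StableEmbeds A A D :=
  ⟨BoundedLatticeHom.id A, fun _ _ h => h, fun _ => le_rfl, fun _ _ => rfl⟩

theorem StableEmbeds.validIn (h : StableEmbeds A B Set.univ) {r : Rule} (hr : r.ValidIn B) :
    r.ValidIn A := by
  obtain ⟨h, hi, -, hd⟩ := h
  intro v hv
  have key : ∀ φ : Formula, φ.eval (fun n => h (v n)) = ⊤ ↔ φ.eval v = ⊤ := fun φ => by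
    rw [φ.eval_map v h fun a => hd a trivial, ← map_top h, hi.eq_iff]
  simpa only [key] using hr (fun n => h (v n)) (by simpa only [key] using hv)

/-- Dually, stability reads `h (mbox a) ≤ mbox (h a)`; iterating from `⊥` sends finite height
upwards, from the subalgebra to the larger algebra. -/
theorem StableEmbeds.mbox_iterate_eq_top {D : Set A} (h : StableEmbeds A B D) {n : ℕ}
    (hn : mbox^[n] (⊥ : A) = ⊤) : mbox^[n] (⊥ : B) = ⊤ := by
  obtain ⟨h, -, hs, -⟩ := h
  have key : ∀ k, h (mbox^[k] ⊥) ≤ mbox^[k] ⊥ := by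
    intro k
    induction k with
    | zero => simp
    | succ k ih =>
      rw [Function.iterate_succ_apply', Function.iterate_succ_apply']
      refine le_trans ?_ (mbox_mono ih)
      rw [mbox, mbox, map_compl']
      refine compl_le_compl ?_
      rw [← map_compl']
      exact hs _
  rw [← top_le_iff, ← map_top h, ← hn]
  exact key n

/-- An algebra refutes a stable canonical rule `ρ(A, D)` if and only if `A` stably embeds in it
with the closed domain condition for `D`. -/
theorem not_validIn_stableCanonicalRule [Finite A] (D : Set A) :
    ¬ (stableCanonicalRule A D).ValidIn B ↔ StableEmbeds A B D := by
  have hprem : ∀ v : ℕ → B, (∀ γ ∈ (stableCanonicalRule A D).prem, γ.eval v = ⊤) ↔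
      (∀ a b : A, (pvar (a ⊔ b)).eval v = (pvar a).eval v ⊔ (pvar b).eval v) ∧
      (∀ a : A, (pvar aᶜ).eval v = ((pvar a).eval v)ᶜ) ∧
      (∀ a : A, dia ((pvar a).eval v) ≤ (pvar (dia a)).eval v) ∧
      (∀ a ∈ D, (pvar (dia a)).eval v ≤ dia ((pvar a).eval v)) := by
    intro v
    simp only [stableCanonicalRule, Finset.mem_union, Finset.mem_image, Finset.mem_univ,
      Finset.mem_filter, true_and, or_imp, forall_and, and_assoc, Prod.exists,
      forall_exists_index, forall_apply_eq_imp_iff, and_imp, forall_apply_eq_imp_iff₂]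
    refine and_congr ⟨fun h a b => ?_, ?_⟩ (by simp)
    · simpa using h _ a b rfl
    · rintro h _ a b rfl
      simpa using h a b
  have hconcl : ∀ v : ℕ → B, (∃ δ ∈ (stableCanonicalRule A D).concl, δ.eval v = ⊤) ↔
      ∃ a : A, a ≠ ⊤ ∧ (pvar a).eval v = ⊤ := by
    intro v
    simp [stableCanonicalRule]
  simp only [Rule.ValidIn, hprem, hconcl]
  push Not
  constructor
  · rintro ⟨v, ⟨h1, h2, h3, h4⟩, h5⟩
    have hinf (a b : A) : (pvar (a ⊓ b)).eval v = (pvar a).eval v ⊓ (pvar b).eval v := by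
      rw [← compl_compl (a ⊓ b), compl_inf, h2, h1, h2, h2, compl_sup, compl_compl, compl_compl]
    have htop : (pvar (⊤ : A)).eval v = ⊤ := by
      rw [← sup_compl_eq_top (x := (⊥ : A)), h1, h2, sup_compl_eq_top]
    have hbot : (pvar (⊥ : A)).eval v = ⊥ := by
      rw [← compl_top, h2, htop, compl_top]
    -- Order reflection is where the conclusions of the rule enter: only `p_⊤` may take the value
    -- `⊤`, and this is applied to `a ⇨ b`.
    have hle (a b : A) (h : (pvar a).eval v ≤ (pvar b).eval v) : a ≤ b := by
      rw [← himp_eq_top_iff]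
      by_contra hne
      refine h5 _ hne ?_
      rw [himp_eq, h1, h2, ← himp_eq, himp_eq_top_iff]
      exact h
    exact ⟨{ toFun := fun a => (pvar a).eval v, map_sup' := h1, map_inf' := hinf,
             map_top' := htop, map_bot' := hbot },
      fun a b h => le_antisymm (hle a b h.le) (hle b a h.ge), h3,
      fun a ha => le_antisymm (h4 a ha) (h3 a)⟩
  · rintro ⟨h, hi, hs, hd⟩
    classical
    let v : ℕ → B := fun n =>
      if hn : n < Nat.card A then h ((Finite.equivFin A).symm ⟨n, hn⟩) else ⊥
    have hv (a : A) : (pvar a).eval v = h a := by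
      simp [pvar, Formula.eval, v]
    refine ⟨v, ?_, ?_⟩
    · simp only [hv]
      exact ⟨map_sup h, map_compl' h, hs, fun a ha => (hd a ha).le⟩
    · intro a ha e
      rw [hv, ← map_top h] at e
      exact ha (hi e)

theorem not_validIn_jankovRule [Finite A] :
    ¬ (jankovRule A).ValidIn B ↔ StableEmbeds A B Set.univ :=
  not_validIn_stableCanonicalRule _

end Algebra

/-! Finite Boolean subalgebras, filtration and local finiteness -/

/-- Agreement below `e` is a congruence. It serves both for splitting along an element and its
complement and for comparing values below `mbox^[k] ⊥`. -/
theorem himp_inf_congr {A : Type u} [HeytingAlgebra A] {a b a' b' e : A}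
    (h : a ⊓ e = a' ⊓ e) (h' : b ⊓ e = b' ⊓ e) : (a ⇨ b) ⊓ e = (a' ⇨ b') ⊓ e := by
  have key : ∀ {a b a' b' : A}, a ⊓ e = a' ⊓ e → b ⊓ e = b' ⊓ e →
      (a ⇨ b) ⊓ e ≤ (a' ⇨ b') ⊓ e := by
    intro a b a' b' h h'
    refine le_inf (le_himp_iff.2 ?_) inf_le_right
    calc (a ⇨ b) ⊓ e ⊓ a' = (a ⇨ b) ⊓ a ⊓ e := by
          rw [inf_assoc, inf_comm e, ← h, inf_assoc]
      _ ≤ b ⊓ e := inf_le_inf_right _ himp_inf_le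
      _ ≤ b' := h' ▸ inf_le_left
  exact le_antisymm (key h h') (key h.symm h'.symm)

theorem compl_inf_congr {A : Type u} [BooleanAlgebra A] {a b e : A}
    (h : a ⊓ e = b ⊓ e) : aᶜ ⊓ e = bᶜ ⊓ e := by
  simpa using himp_inf_congr h (rfl : (⊥ : A) ⊓ e = ⊥ ⊓ e)

/-- The Boolean subalgebra obtained by adjoining one element. -/
def adjoinElement {A : Type u} [BooleanAlgebra A] (M : BooleanSubalgebra A) (g : A) :
    BooleanSubalgebra A where
  carrier := {x | (∃ a ∈ M, x ⊓ g = a ⊓ g) ∧ ∃ b ∈ M, x ⊓ gᶜ = b ⊓ gᶜ}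
  supClosed' := by
    rintro x ⟨⟨a, ha, ea⟩, b, hb, eb⟩ y ⟨⟨c, hc, ec⟩, d, hd, ed⟩
    exact ⟨⟨a ⊔ c, M.sup_mem ha hc, by rw [inf_sup_right, ea, ec, inf_sup_right]⟩,
      b ⊔ d, M.sup_mem hb hd, by rw [inf_sup_right, eb, ed, inf_sup_right]⟩
  infClosed' := by
    rintro x ⟨⟨a, ha, ea⟩, b, hb, eb⟩ y ⟨⟨c, hc, ec⟩, d, hd, ed⟩
    exact ⟨⟨a ⊓ c, M.inf_mem ha hc, by
        rw [inf_inf_distrib_right, ea, ec, ← inf_inf_distrib_right]⟩,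
      b ⊓ d, M.inf_mem hb hd, by rw [inf_inf_distrib_right, eb, ed, ← inf_inf_distrib_right]⟩
  compl_mem' := by
    rintro x ⟨⟨a, ha, ea⟩, b, hb, eb⟩
    exact ⟨⟨aᶜ, M.compl_mem ha, compl_inf_congr ea⟩, bᶜ, M.compl_mem hb, compl_inf_congr eb⟩
  bot_mem' := ⟨⟨⊥, M.bot_mem, rfl⟩, ⊥, M.bot_mem, rfl⟩

/-- Generators are adjoined one at a time; each new element is determined by a pair from the old
subalgebra, one member giving its part below `g` and the other its part below `gᶜ`. -/
theorem exists_finite_booleanSubalgebra {A : Type u} [BooleanAlgebra A] {s : Set A}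
    (hs : s.Finite) : ∃ M : BooleanSubalgebra A, (M : Set A).Finite ∧ s ⊆ M := by
  induction s, hs using Set.Finite.induction_on with
  | empty =>
    refine ⟨⟨⟨{⊥, ⊤}, ?_, ?_⟩, ?_, ?_⟩, Set.toFinite {⊥, ⊤}, Set.empty_subset _⟩
    · rintro a (rfl | rfl) b (rfl | rfl) <;> simp
    · rintro a (rfl | rfl) b (rfl | rfl) <;> simp
    · rintro a (rfl | rfl) <;> simp
    · simp
  | @insert g s _ _ ih =>
    obtain ⟨M, hM, hsM⟩ := ih
    refine ⟨adjoinElement M g, ?_, ?_⟩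
    · refine (Set.Finite.image2 (fun a b => a ⊓ g ⊔ b ⊓ gᶜ) hM hM).subset ?_
      rintro x ⟨⟨a, ha, ea⟩, b, hb, eb⟩
      refine ⟨a, ha, b, hb, ?_⟩
      change a ⊓ g ⊔ b ⊓ gᶜ = x
      rw [← ea, ← eb, sup_inf_inf_compl]
    · refine Set.insert_subset ?_ fun x hx => ⟨⟨x, hsM hx, rfl⟩, x, hsM hx, rfl⟩
      exact ⟨⟨⊤, M.top_mem, by simp⟩, ⊥, M.bot_mem, by simp⟩

section Subalgebras

variable {B : Type u} [ModalAlgebra B] (M : BooleanSubalgebra B)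

/-- A Boolean subalgebra closed under `dia`, as a modal algebra. -/
def modalSubalgebra (hM : ∀ a ∈ M, dia a ∈ M) : ModAlg.{u} :=
  letI : ModalAlgebra M :=
    { dia := fun a => ⟨dia (a : B), hM a a.2⟩
      dia_bot := Subtype.ext ModalAlgebra.dia_bot
      dia_sup := fun a b => Subtype.ext (ModalAlgebra.dia_sup (a : B) b) }
  ⟨M⟩

theorem stableEmbeds_modalSubalgebra (hM : ∀ a ∈ M, dia a ∈ M) :
    StableEmbeds (modalSubalgebra M hM) B Set.univ :=
  ⟨M.subtype, Subtype.val_injective, fun _ => le_rfl, fun _ _ => rfl⟩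

/-- The least element of a finite Boolean subalgebra above the possibility of `a`. -/
noncomputable def filtDia [Fintype M] (a : M) : M :=
  open Classical in (Finset.univ.filter fun b : M => dia (a : B) ≤ b).inf id

theorem filtDia_le_iff [Fintype M] {a b : M} : filtDia M a ≤ b ↔ dia (a : B) ≤ b := by
  classical
  constructor
  · intro hb
    have : ∀ s : Finset M, (∀ c ∈ s, dia (a : B) ≤ c) → dia (a : B) ≤ (s.inf id : M) := by
      intro s
      induction s using Finset.induction_on with
      | empty => simp
      | insert c s _ ih =>
        intro h
        rw [Finset.inf_insert]
        exact le_inf (h c (by simp)) (ih fun d hd => h d (by simp [hd]))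
    exact le_trans (this _ (by simp)) (show ((filtDia M a : M) : B) ≤ b from hb)
  · intro h
    exact Finset.inf_le (f := id) (by simpa using h)

/-- The least filtration through a finite Boolean subalgebra. -/
noncomputable def filtration [Fintype M] : ModAlg.{u} :=
  letI : ModalAlgebra M :=
    { dia := filtDia M
      dia_bot := by
        rw [eq_bot_iff, filtDia_le_iff]
        exact ModalAlgebra.dia_bot.le
      dia_sup := fun a b => eq_of_forall_ge_iff fun c => by
        rw [sup_le_iff, filtDia_le_iff, filtDia_le_iff, filtDia_le_iff, ← sup_le_iff,
          ← ModalAlgebra.dia_sup]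
        rfl }
  ⟨M⟩

/-- The new operator rounds `dia` up into `M`, which is exactly the inequality that stability asks
of the inclusion. -/
theorem stableEmbeds_filtration [Fintype M] : StableEmbeds (filtration M) B ∅ :=
  ⟨M.subtype, Subtype.val_injective, fun _ => (filtDia_le_iff M).1 le_rfl, fun _ h => h.elim⟩

theorem filtDia_of_mem [Fintype M] (a : M) (h : dia (a : B) ∈ M) :
    (filtDia M a : B) = dia (a : B) :=
  le_antisymm ((filtDia_le_iff M (b := ⟨_, h⟩)).2 le_rfl) ((filtDia_le_iff M).1 le_rfl)

/-- The filtration lemma: `dia` is rounded only where its value leaves `M`, and this never happens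
on the relevant subformulas. -/
theorem eval_filtration [Fintype M] (v : ℕ → B) (φ : Formula) :
    ∀ (v' : ℕ → filtration M) (_ : ∀ n, v n ∈ M → M.subtype (v' n) = v n),
    φ.subvalues v ⊆ M → M.subtype (φ.eval (A := filtration M) v') = φ.eval v := by
  intro v' hv'
  induction φ with
  | var n => exact fun h => hv' n (h rfl)
  | bot => exact fun _ => rfl
  | imp φ ψ h1 h2 =>
    intro h
    change _ = φ.eval v ⇨ ψ.eval v
    rw [← h1 (Set.subset_union_left.trans h), ← h2 (Set.subset_union_right.trans h)]
    rfl
  | box φ h1 =>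
    intro h
    have e := h1 ((Set.subset_insert _ _).trans h)
    have hm : mbox (φ.eval v) ∈ M := h (Set.mem_insert _ _)
    rw [mbox, BooleanSubalgebra.compl_mem_iff, ← e] at hm
    change _ = mbox (φ.eval v)
    rw [← e]
    exact congrArg compl (filtDia_of_mem M _ hm)

end Subalgebras

/-! ### Finite algebras refuting a given rule -/

section Finiteness

variable {B : Type u} [ModalAlgebra B]

/-- A refuted rule is refuted in a finite stable subalgebra. -/
theorem exists_finite_stableEmbeds {r : Rule} (hr : ¬ r.ValidIn B) :
    ∃ A : ModAlg.{u}, Finite A ∧ StableEmbeds A B ∅ ∧ ¬ r.ValidIn A := by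
  classical
  simp only [Rule.ValidIn, not_forall, not_exists, not_and] at hr
  obtain ⟨v, hp, hc⟩ := hr
  have hfin : (⋃ φ ∈ r.prem ∪ r.concl, φ.subvalues v).Finite :=
    Set.Finite.biUnion (Finset.finite_toSet _) fun φ _ => φ.finite_subvalues v
  obtain ⟨M, hM, hs⟩ := exists_finite_booleanSubalgebra hfin
  let : Fintype M := hM.fintype
  let v' : ℕ → filtration M := fun n => if h : v n ∈ M then (⟨v n, h⟩ : M) else (⊥ : M)
  have hv' : ∀ n, v n ∈ M → M.subtype (v' n) = v n := by
    intro n h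
    simp [v', h]
  have key : ∀ φ ∈ r.prem ∪ r.concl, φ.eval v' = ⊤ ↔ φ.eval v = ⊤ := by
    intro φ hφ
    have e := eval_filtration M v φ v' hv' ((Set.subset_biUnion_of_mem hφ).trans hs)
    rw [← e]
    exact ⟨fun h => congrArg M.subtype h, fun h => Subtype.val_injective h⟩
  refine ⟨filtration M, hM, stableEmbeds_filtration M, fun h => ?_⟩
  obtain ⟨δ, hδ, e⟩ := h v' fun γ hγ =>
    (key γ (Finset.mem_union_left _ hγ)).2 (hp γ hγ)
  exact hc δ hδ ((key δ (Finset.mem_union_right _ hδ)).1 e)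

/-- In an algebra of finite height, finitely many elements have finitely many values of modal
terms. -/
theorem finite_range_eval {n : ℕ} (hn : mbox^[n] (⊥ : B) = ⊤) {v : ℕ → B}
    (hv : (Set.range v).Finite) : (Set.range fun φ : Formula => φ.eval v).Finite := by
  -- Work modulo `mbox^[k] ⊥`: at `k = 0` all values agree, and at `k = n` agreement is equality.
  -- Since `mbox` preserves meets, the value of a boxed formula at level `k + 1` depends only on its
  -- body at level `k`, so boxes of the finitely many elements of `M` suffice.
  have key : ∀ k, ∃ M : BooleanSubalgebra B, (M : Set B).Finite ∧
      ∀ φ : Formula, ∃ y ∈ M, φ.eval v ⊓ mbox^[k] ⊥ = y ⊓ mbox^[k] ⊥ := by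
    intro k
    induction k with
    | zero =>
      obtain ⟨M, hM, -⟩ := exists_finite_booleanSubalgebra hv
      exact ⟨M, hM, fun φ => ⟨⊥, M.bot_mem, by simp⟩⟩
    | succ k ih =>
      obtain ⟨M, hM, hk⟩ := ih
      obtain ⟨N, hN, hs⟩ := exists_finite_booleanSubalgebra (hv.union (hM.image mbox))
      refine ⟨N, hN, fun φ => ?_⟩
      induction φ with
      | var m => exact ⟨v m, hs (Or.inl ⟨m, rfl⟩), rfl⟩
      | bot => exact ⟨⊥, N.bot_mem, rfl⟩
      | imp φ ψ h1 h2 =>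
        obtain ⟨a, ha, ea⟩ := h1
        obtain ⟨b, hb, eb⟩ := h2
        exact ⟨a ⇨ b, N.himp_mem ha hb, himp_inf_congr ea eb⟩
      | box φ _ =>
        obtain ⟨a, ha, ea⟩ := hk φ
        refine ⟨mbox a, hs (Or.inr ⟨a, ha, rfl⟩), ?_⟩
        rw [Function.iterate_succ_apply', Formula.eval, ← mbox_inf, ← mbox_inf, ea]
  obtain ⟨M, hM, h⟩ := key n
  refine hM.subset ?_
  rintro _ ⟨φ, rfl⟩
  obtain ⟨y, hy, e⟩ := h φ
  rw [hn, inf_top_eq, inf_top_eq] at e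
  change φ.eval v ∈ M
  rwa [e]

/-- The values of modal terms form a Boolean subalgebra. -/
def evalSubalgebra (v : ℕ → B) : BooleanSubalgebra B where
  carrier := Set.range fun φ : Formula => φ.eval v
  supClosed' := by
    rintro _ ⟨φ, rfl⟩ _ ⟨ψ, rfl⟩
    exact ⟨φ.or ψ, by simp⟩
  infClosed' := by
    rintro _ ⟨φ, rfl⟩ _ ⟨ψ, rfl⟩
    exact ⟨(φ.neg.or ψ.neg).neg, by simp⟩
  compl_mem' := by
    rintro _ ⟨φ, rfl⟩
    exact ⟨φ.neg, by simp⟩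
  bot_mem' := ⟨Formula.bot, rfl⟩

/-- In an algebra of finite height, a refuted rule is refuted in a finite subalgebra. -/
theorem exists_finite_subalgebra {n : ℕ} (hn : mbox^[n] (⊥ : B) = ⊤) {r : Rule}
    (hr : ¬ r.ValidIn B) :
    ∃ A : ModAlg.{u}, Finite A ∧ StableEmbeds A B Set.univ ∧ ¬ r.ValidIn A := by
  classical
  simp only [Rule.ValidIn, not_forall, not_exists, not_and] at hr
  obtain ⟨v, hp, hc⟩ := hr
  obtain ⟨N, hN⟩ := ((Filter.eventually_all_finset (r.prem ∪ r.concl)).2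
    fun φ _ => φ.eventually_eval_congr (A := B)).exists
  -- The rule involves only variables below `N`; sending the rest to `⊥` makes the range finite, so
  -- that its generated modal subalgebra is finite.
  let w : ℕ → B := fun m => if m < N then v m else ⊥
  have hw : (Set.range w).Finite := by
    refine (((Set.finite_lt_nat N).image v).insert ⊥).subset ?_
    rintro _ ⟨m, rfl⟩
    by_cases h : m < N
    · exact Or.inr ⟨m, h, by simp [w, h]⟩
    · exact Or.inl (by simp [w, h])
  have hwv : ∀ φ ∈ r.prem ∪ r.concl, φ.eval w = φ.eval v := fun φ hφ =>
    hN φ hφ w v fun m hm => by simp [w, hm]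
  have hd : ∀ a ∈ evalSubalgebra w, dia a ∈ evalSubalgebra w := by
    rintro _ ⟨φ, rfl⟩
    exact ⟨φ.dia, by simp⟩
  refine ⟨modalSubalgebra _ hd, finite_range_eval hn hw, stableEmbeds_modalSubalgebra _ hd,
    fun h => ?_⟩
  let w' : ℕ → modalSubalgebra _ hd := fun m => (⟨w m, .var m, rfl⟩ : evalSubalgebra w)
  have key : ∀ φ ∈ r.prem ∪ r.concl, φ.eval w' = ⊤ ↔ φ.eval v = ⊤ := by
    intro φ hφ
    have e : φ.eval w = (evalSubalgebra w).subtype (φ.eval (A := modalSubalgebra _ hd) w') :=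
      φ.eval_map (A := modalSubalgebra _ hd) w' (evalSubalgebra w).subtype fun _ => rfl
    rw [← hwv φ hφ, e]
    exact ⟨fun h => congrArg (evalSubalgebra w).subtype h, fun h => Subtype.val_injective h⟩
  obtain ⟨δ, hδ, e⟩ := h w' fun γ hγ =>
    (key γ (Finset.mem_union_left _ hγ)).2 (hp γ hγ)
  exact hc δ hδ ((key δ (Finset.mem_union_right _ hδ)).1 e)

end Finiteness

/-! Rule systems and universal classes -/

/-- The rule system of the rules valid in an algebra. -/
def ruleSystemOf (A : Type u) [ModalAlgebra A] : RuleSystem where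
  carrier := {r | r.ValidIn A}
  refl_mem φ v h := ⟨φ, by simpa using h⟩
  mp_mem φ ψ v h := by
    simp only [Finset.mem_insert, Finset.mem_singleton, forall_eq_or_imp, forall_eq,
      Formula.eval_imp_eq_top] at h
    exact ⟨ψ, by simp, top_le_iff.1 (h.1 ▸ h.2)⟩
  nec_mem φ v h := ⟨φ.box, by simp, by
    simp only [Finset.mem_singleton, forall_eq] at h
    rw [Formula.eval, h, mbox_top]⟩
  thm_mem φ h v _ := ⟨φ, by simp, h.eval_eq_top v⟩
  weakening Γ Γ' Δ Δ' h v hv := by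
    obtain ⟨δ, hδ, e⟩ := h v fun γ hγ => hv γ (Finset.mem_union_left _ hγ)
    exact ⟨δ, Finset.mem_union_left _ hδ, e⟩
  cut Γ Δ φ h h' v hv := by
    obtain ⟨δ, hδ, e⟩ := h v hv
    rcases Finset.mem_insert.1 hδ with rfl | hδ
    · refine h' v fun γ hγ => ?_
      rcases Finset.mem_insert.1 hγ with rfl | hγ
      exacts [e, hv γ hγ]
    · exact ⟨δ, hδ, e⟩
  subst_mem Γ Δ s h v hv := by
    obtain ⟨δ, hδ, e⟩ := h (fun n => (s n).eval v) fun γ hγ => by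
      rw [← Formula.eval_subst]
      exact hv _ (Finset.mem_image_of_mem _ hγ)
    exact ⟨δ.subst s, Finset.mem_image_of_mem _ hδ, by rwa [Formula.eval_subst]⟩

namespace RuleSystem

variable {S T : RuleSystem} {R : Set Rule}

theorem le_ruleSystemOf_iff {A : ModAlg.{u}} : S ≤ ruleSystemOf A ↔ A ∈ U S := Iff.rfl

theorem U_antitone (h : S ≤ T) : U.{u} T ⊆ U S := fun _ hA r hr => hA r (h hr)

theorem le_add : S ≤ S.add R := fun _ hr _ hS _ => hS hr

theorem subset_add : R ⊆ (S.add R).carrier := fun _ hr _ _ hR => hR hr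

theorem add_le_iff : S.add R ≤ T ↔ S ≤ T ∧ R ⊆ T.carrier :=
  ⟨fun h => ⟨le_add.trans h, subset_add.trans h⟩, fun h _ hr => hr T h.1 h.2⟩

theorem mem_U_add_iff {A : ModAlg.{u}} :
    A ∈ U (S.add R) ↔ A ∈ U S ∧ ∀ r ∈ R, r.ValidIn A :=
  add_le_iff (T := ruleSystemOf A)

theorem U_add_subset (R : Set Rule) (C : Set ModAlg.{u})
    (h : ∀ B : ModAlg.{u}, ∀ r ∈ R, ¬ r.ValidIn B → B ∈ C) : U S ⊆ U (S.add R) ∪ C := by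
  intro B hB
  by_contra hne
  rw [Set.mem_union, mem_U_add_iff] at hne
  push Not at hne
  obtain ⟨r, hr, hn⟩ := hne.1 hB
  exact hne.2 (h B r hr hn)

theorem U_subset_of_stableCanonicalRules {Q : Set Rule}
    (hQ : Q ⊆ stableCanonicalRulesOf (FinAlg.{u} ∩ FH)) : U.{u} S ⊆ U (S.add Q) ∪ FH := by
  refine U_add_subset Q FH fun B r hr hn => ?_
  obtain ⟨A, _, D, ⟨-, n, hA⟩, rfl⟩ := hQ hr
  exact ⟨n, ((not_validIn_stableCanonicalRule D).1 hn).mbox_iterate_eq_top hA⟩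

theorem jankovRulesOf_subset (C : Set ModAlg.{u}) :
    jankovRulesOf (C ∩ FinAlg ∩ FH) ⊆ stableCanonicalRulesOf (FinAlg.{u} ∩ FH) := by
  rintro r ⟨A, hA, h, rfl⟩
  exact ⟨A, hA, Set.univ, ⟨h.1.2, h.2⟩, rfl⟩

/-- Universal classes are closed under subalgebras. -/
theorem mem_U_of_stableEmbeds_univ {A B : ModAlg.{u}} (h : StableEmbeds A B Set.univ)
    (hB : B ∈ U T) : A ∈ U T := fun r hr => h.validIn (hB r hr)

/-- The Jankov rule of a finite algebra belongs exactly to the rule systems that the algebra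
does not validate. -/
theorem jankovRule_mem_iff {A : ModAlg.{u}} [Finite A] :
    jankovRule A ∈ T.carrier ↔ A ∉ U T := by
  constructor
  · intro h hA
    exact not_validIn_jankovRule.2 (StableEmbeds.refl A _) (hA _ h)
  · intro hA
    by_contra h
    -- By completeness some `T`-algebra refutes the Jankov rule, so it contains `A` as a subalgebra.
    obtain ⟨B, hB, hr⟩ := T.exists_refuting h
    exact hA (mem_U_of_stableEmbeds_univ (not_validIn_jankovRule.1 hr) hB)

/-- All Jankov rules of the permitted kind that lie in `T` are taken as axioms. Stability of `S` is
needed only for the filtration, which is not a genuine subalgebra. -/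
theorem axiomatized_of_finite (hS : IsStable.{u} S) (hST : S ≤ T)
    (h : U.{u} S ∩ FinAlg ⊆ U T ∪ FH) :
    AxiomatizedOverBy T S (jankovRulesOf (U.{u} S ∩ FinAlg ∩ FH)) := by
  refine ⟨jankovRulesOf (U.{u} S ∩ FinAlg ∩ FH) ∩ T.carrier, Set.inter_subset_left,
    le_antisymm (fun r hr => ?_) (add_le_iff.2 ⟨hST, Set.inter_subset_right⟩)⟩
  by_contra hne
  obtain ⟨B, hB, hrB⟩ := exists_refuting.{u} _ hne
  rw [mem_U_add_iff] at hB
  obtain ⟨A, hA, hAB, hrA⟩ := exists_finite_stableEmbeds hrB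
  obtain ⟨n, hn⟩ := (h ⟨hS A B hB.1 hAB, hA⟩).resolve_left fun hA => hrA (hA r hr)
  -- `A` is only stably embedded, so `B` need not refute its Jankov rule; the finite height
  -- transferred to `B` provides a genuine subalgebra instead.
  obtain ⟨C, hC, hCB, hrC⟩ := exists_finite_subalgebra (hAB.mbox_iterate_eq_top hn) hrB
  have hCS : C ∈ U S := mem_U_of_stableEmbeds_univ hCB hB.1
  have hCT : C ∉ U T := fun hC => hrC (hC r hr)
  exact not_validIn_jankovRule.2 hCB (hB.2 _
    ⟨⟨C, hC, ⟨⟨hCS, hC⟩, (h ⟨hCS, hC⟩).resolve_left hCT⟩, rfl⟩, jankovRule_mem_iff.2 hCT⟩)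

/-- A rule system over `S` either contains the Jankov rule or is valid in `A`; in the latter case it
lies below `ruleSystemOf A`. -/
theorem isSplitting_add_jankovRule {A : ModAlg.{u}} [Finite A] (hA : A ∈ U S) :
    IsSplitting (⟨S.add {jankovRule A}, le_add⟩ : NExt S) := by
  refine ⟨⟨ruleSystemOf A, le_ruleSystemOf_iff.2 hA⟩, fun h => ?_, fun z => ?_⟩
  · exact not_validIn_jankovRule.2 (StableEmbeds.refl A _)
      (h (subset_add (Set.mem_singleton _)))
  · by_cases h : jankovRule A ∈ z.1.carrier
    · exact Or.inl (add_le_iff.2 ⟨z.2, Set.singleton_subset_iff.2 h⟩)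
    · exact Or.inr (le_ruleSystemOf_iff.2 (not_not.1 (mt jankovRule_mem_iff.2 h)))

theorem isUnionSplitting_of_axiomatized (T : NExt S)
    (h : AxiomatizedOverBy T.1 S (jankovRulesOf (U.{u} S))) : IsUnionSplitting T := by
  obtain ⟨R, hR, hT⟩ := h
  refine ⟨(fun r => (⟨S.add {r}, le_add⟩ : NExt S)) '' R, ?_, ?_, ?_⟩
  · rintro _ ⟨r, hr, rfl⟩
    obtain ⟨A, _, hA, rfl⟩ := hR hr
    exact isSplitting_add_jankovRule hA
  · rintro _ ⟨r, hr, rfl⟩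
    refine add_le_iff.2 ⟨T.2, Set.singleton_subset_iff.2 ?_⟩
    rw [hT]
    exact subset_add hr
  · intro z hz
    change T.1 ≤ z.1
    rw [hT, add_le_iff]
    exact ⟨z.2, fun r hr => (add_le_iff.1 (hz ⟨r, hr, rfl⟩)).2 rfl⟩

end RuleSystem

end ModalRules

theorem theorem4 (S : RuleSystem) (hS : RuleSystem.IsStable.{u} S) (S' : NExt S) :
    List.TFAE
      [ U.{u} S ⊆ U S'.1 ∪ FH,
        U.{u} S ∩ FinAlg ⊆ U S'.1 ∪ FH,
        AxiomatizedOverBy S'.1 S (jankovRulesOf (U.{u} S ∩ FinAlg ∩ FH)),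
        AxiomatizedOverBy S'.1 S (stableCanonicalRulesOf (FinAlg.{u} ∩ FH)),
        S'.1 ≤ S.add (jankovRulesOf (U.{u} S ∩ FinAlg ∩ FH)) ] ∧
    (U.{u} S ⊆ U S'.1 ∪ FH → IsUnionSplitting S') := by
  have h23 := RuleSystem.axiomatized_of_finite hS S'.2
  refine ⟨?_, fun h => ?_⟩
  · tfae_have 1 → 2 := fun h => Set.inter_subset_left.trans h
    tfae_have 2 → 3 := h23
    tfae_have 3 → 4 := fun ⟨R, hR, e⟩ =>
      ⟨R, hR.trans (RuleSystem.jankovRulesOf_subset _), e⟩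
    tfae_have 4 → 1 := fun ⟨R, hR, e⟩ => by
      rw [e]
      exact RuleSystem.U_subset_of_stableCanonicalRules hR
    tfae_have 3 → 5 := fun ⟨R, hR, e⟩ => by
      rw [e, RuleSystem.add_le_iff]
      exact ⟨RuleSystem.le_add, hR.trans RuleSystem.subset_add⟩
    -- The system with all these Jankov rules satisfies 1, and a smaller system has a larger
    -- universal class.
    tfae_have 5 → 1 := fun h =>
      (RuleSystem.U_subset_of_stableCanonicalRules (RuleSystem.jankovRulesOf_subset _)).trans
        (Set.union_subset_union_left _ (RuleSystem.U_antitone h))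
    tfae_finish
  · obtain ⟨R, hR, e⟩ := h23 (Set.inter_subset_left.trans h)
    refine RuleSystem.isUnionSplitting_of_axiomatized S' ⟨R, fun r hr => ?_, e⟩
    obtain ⟨A, hA, h, rfl⟩ := hR hr
    exact ⟨A, hA, h.1.1, rfl⟩
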